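/- Let $P$ be a convex quadrilateral in $\mathbb C$ with no three vertices on one side, with vertices $w_0,w_1,w_2,w_3$ listed counterclockwise (indices mod $4$), and let $\boldsymbol\lambda=(\lambda_0,\dots,\lambda_3)\in(0,1)^4$. For $z\in X:=\mathbb C\setminus P$ let $L_z$ be the ray from $z$ that is tangent to $P$ and has $P$ on its left. The singular set $\mathcal S$ is the set of $z\in X$ for which $L_z$ contains a side of $P$, and for $z\in X\setminus\mathcal S$ the dissipative outer billiard map is $$T_{P,\boldsymbol\lambda}(z)=-\lambda_i z+(1+\lambda_i)w_i\qquad\text{if } L_z\cap P=\{w_i\}.$$ A point $z\in X$ is non-singular if its forward orbit never meets $\mathcal S$, and $\omega(T_{P,\boldsymbol\lambda})$ denotes the union of the $\omega$-limit sets of all non-singular points. The map $T_{P,\boldsymbol\lambda}$ is called asymptotically periodic if $\omega(T_{P,\boldsymbol\lambda})$ is the union of finitely many periodic orbits, and the forward orbit of every non-singular point converges to one of them. Let $\mathcal P_4$ be the set of pairs $(P,\boldsymbol\lambda)$ as above with $w_0=0$, with the sup distance $\|\cdot\|$ in the coordinates $(w_1,w_2,w_3,\boldsymbol\lambda)\in\mathbb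 R^6\times\mathbb R^4$. Let $\Lambda$ be the set of all roots in $[0,1)$ of the polynomials $x^{2n}-x^n-x^{n-1}+1$, $n\ge1$ (the bifurcation values of the square). **Theorem.** Let $P$ be the unit square with vertices $0,-i,1-i,1$, let $\lambda\in(0,1)\setminus\Lambda$, and let $\boldsymbol\lambda=(\lambda,\lambda,\lambda,\lambda)$. For every $\epsilon>0$ there is $\delta>0$ such that for every $(P',\boldsymbol\lambda')\in\mathcal P_4$ with $\|(P',\boldsymbol\lambda')-(P,\boldsymbol\lambda)\|<\delta$: 1. $T_{P',\boldsymbol\lambda'}$ is asymptotically periodic; 2. $\operatorname{card}\omega(T_{P',\boldsymbol\lambda'})=\operatorname{card}\omega(T_{P,\boldsymbol\lambda})$; 3. the Hausdorff distance of $\omega(T_{P',\boldsymbol\lambda'})$ and $\omega(T_{P,\boldsymbol\lambda})$ is less than $\epsilon$; 4. there is a bijection from the periodic orbits of $T_{P,\boldsymbol\lambda}$ onto those of $T_{P',\boldsymbol\lambda'}$ such that corresponding orbits have the same (least) period and Hausdorff distance less than $\epsilon$. -/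

import Mathlib

open Set Filter Topology

namespace OuterBilliard

/-- The planar cross product `u × v`; it is positive when `v` points to the left of `u`. -/
def cross (u v : ℂ) : ℝ := u.re * v.im - u.im * v.re

/-- The closed polygonal region with vertices `w`. -/
def polygon {k : ℕ} (w : Fin k → ℂ) : Set ℂ := convexHull ℝ (range w)

/-- `w 0, w 1, …` (indices modulo `k`) are the vertices of a convex `k`-gon, listed along its
positively oriented boundary, with no more than two vertices on the same side: all the other
vertices lie strictly to the left of each oriented side `w i ⟶ w (i + 1)`. -/
def IsConvexPolygon {k : ℕ} [NeZero k] (w : Fin k → ℂ) : Prop :=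
  3 ≤ k ∧ ∀ i j : Fin k, j ≠ i → j ≠ i + 1 → 0 < cross (w (i + 1) - w i) (w j - w i)

/-- The space of pairs (polygon, contraction rates): convex `k`-gons with a vertex, namely `w 0`,
at the origin, and rates in `(0,1)`; the rate `p.2 i` is the one of the vertex `p.1 i`. -/
def Params (k : ℕ) [NeZero k] : Set ((Fin k → ℂ) × (Fin k → ℝ)) :=
  {p | IsConvexPolygon p.1 ∧ p.1 0 = 0 ∧ ∀ i, p.2 i ∈ Ioo (0 : ℝ) 1}

/-- The sup distance between pairs: the largest absolute difference of the real and imaginary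
parts of the vertices and of the rates. -/
noncomputable def paramDist {k : ℕ} (p q : (Fin k → ℂ) × (Fin k → ℝ)) : ℝ :=
  ‖((fun i => ((p.1 i - q.1 i).re, (p.1 i - q.1 i).im), p.2 - q.2) :
    (Fin k → ℝ × ℝ) × (Fin k → ℝ))‖

/-- The open cone of the points `z` whose tangent ray (the ray from `z` that leaves the polygon on
its left) touches the polygon exactly at the vertex `w i`. -/
def cone {k : ℕ} (w : Fin k → ℂ) (i : Fin k) : Set ℂ :=
  {z | ∀ j, j ≠ i → 0 < cross (w i - z) (w j - z)}

/-- The singular set: the points outside the polygon whose tangent ray contains a side, i.e. the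
union of the half-lines that extend the oriented sides `w i ⟶ w (i + 1)` backwards. -/
def singularSet {k : ℕ} [NeZero k] (w : Fin k → ℂ) : Set ℂ :=
  {z | z ∉ polygon w ∧ ∃ i : Fin k, ∃ t : ℝ, 0 < t ∧ z = w i + (t : ℂ) * (w i - w (i + 1))}

open Classical in
/-- The dissipative outer billiard map, `z ↦ -λ_i z + (1 + λ_i) w_i` on the `i`-th cone. The cones
are pairwise disjoint. Outside the cones, where the billiard map is undefined, the value `z` is
irrelevant. -/
noncomputable def billiardMap {k : ℕ} (p : (Fin k → ℂ) × (Fin k → ℝ)) (z : ℂ) : ℂ :=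
  if h : ∃ i, z ∈ cone p.1 i then
    -(p.2 h.choose : ℂ) * z + (1 + (p.2 h.choose : ℂ)) * p.1 h.choose
  else z

/-- A point outside the polygon is non-singular if its forward orbit never meets the singular
set. -/
def NonSingular {k : ℕ} [NeZero k] (p : (Fin k → ℂ) × (Fin k → ℝ)) (z : ℂ) : Prop :=
  z ∉ polygon p.1 ∧ ∀ n : ℕ, (billiardMap p)^[n] z ∉ singularSet p.1

/-- The `ω`-limit set of the billiard map: the union of the `ω`-limit sets of all non-singular
points. -/
noncomputable def limitSet {k : ℕ} [NeZero k] (p : (Fin k → ℂ) × (Fin k → ℝ)) : Set ℂ :=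
  ⋃ z ∈ {z | NonSingular p z}, omegaLimit atTop (fun (n : ℕ) x => (billiardMap p)^[n] x) {z}

/-- `Γ` is a periodic orbit of the billiard map. -/
def IsPeriodicOrbit {k : ℕ} [NeZero k] (p : (Fin k → ℂ) × (Fin k → ℝ)) (Γ : Set ℂ) : Prop :=
  ∃ z, NonSingular p z ∧ (∃ n : ℕ, 0 < n ∧ (billiardMap p)^[n] z = z) ∧
    Γ = range (fun n : ℕ => (billiardMap p)^[n] z)

/-- The `ω`-limit set is the union of finitely many periodic orbits, and the forward orbit of every
non-singular point converges to one of them. -/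
def AsymptoticallyPeriodic {k : ℕ} [NeZero k] (p : (Fin k → ℂ) × (Fin k → ℝ)) : Prop :=
  ∃ G : Set (Set ℂ), G.Finite ∧ (∀ Γ ∈ G, IsPeriodicOrbit p Γ) ∧ limitSet p = ⋃₀ G ∧
    ∀ z, NonSingular p z → ∃ Γ ∈ G,
      Tendsto (fun n : ℕ => Metric.infDist ((billiardMap p)^[n] z) Γ) atTop (𝓝 0)

/-- The unit square with corners `0, -i, 1 - i, 1` and all four rates equal to `lam`. -/
noncomputable def squareParam (lam : ℝ) : (Fin 4 → ℂ) × (Fin 4 → ℝ) :=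
  (![0, -Complex.I, 1 - Complex.I, 1], fun _ => lam)

/-- The bifurcation values of the square: the roots in `[0,1)` of the polynomials
`x^(2n) - x^n - x^(n-1) + 1`, `n ≥ 1`. -/
def bifurcationValues : Set ℝ :=
  {x | 0 ≤ x ∧ x < 1 ∧ ∃ n : ℕ, 1 ≤ n ∧ x ^ (2 * n) - x ^ n - x ^ (n - 1) + 1 = 0}

end OuterBilliard

/-! # Stability of the asymptotic dynamics of dissipative outer billiards near the square -/

/-! ### Geometry of cones, branches and the singular set. -/

namespace OuterBilliard

/-! Weak orbits (`IsWeakOrbit`) satisfy only closed conditions, so they form a closed set jointly in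
the parameter and the sequence, and every non-singular orbit is one of them. Suppose that all weak
orbits of `p₀` come arbitrarily close to a finite invariant set `Q` inside the open cones. By
compactness, the non-singular orbits of every nearby `p` then enter small balls around `Q`. On each
ball the map of `p` is a single affine contraction, and it carries the balls into one another along
the orbits of `p₀`. Hence each periodic point in `Q` has a unique periodic continuation, and every
trapped orbit converges to a continued periodic orbit. This is `eventually_exists_isModel`;
`IsModel.asymptoticallyPeriodic` and `IsModel.correspondence` read off the four claims.

For the square, symmetry reduces the map to a quadrant with two branches, `stepA` and `stepB`. After
a step A the abscissa is at most 1. The return map through `n` steps B and one step A is a quarter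
turn scaled by `lam ^ (n + 1)`, up to translation. The number `n` cannot grow along a weak orbit, so
it stabilizes and the returns converge to `fixPt lam n`, whose abscissa is at most 1. Abscissa 1
forces `lam` to be a bifurcation value; abscissa below 1 puts the whole periodic orbit inside the
open cones. This is `exists_dist_reducedPeriodic_lt`. -/

lemma continuous_cross : Continuous fun q : ℂ × ℂ => cross q.1 q.2 := by
  unfold cross; fun_prop

/-- The affine branch of the billiard map that belongs to the vertex `w i`. -/
noncomputable def branch {k : ℕ} (p : (Fin k → ℂ) × (Fin k → ℝ)) (i : Fin k) (z : ℂ) : ℂ :=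
  -(p.2 i : ℂ) * z + (1 + (p.2 i : ℂ)) * p.1 i

variable {k : ℕ} {p : (Fin k → ℂ) × (Fin k → ℝ)} {w : Fin k → ℂ} {i j : Fin k} {z x : ℂ}

lemma branch_re (p : (Fin k → ℂ) × (Fin k → ℝ)) (i : Fin k) (z : ℂ) :
    (branch p i z).re = -p.2 i * z.re + (1 + p.2 i) * (p.1 i).re := by
  simp [branch]

lemma branch_im (p : (Fin k → ℂ) × (Fin k → ℝ)) (i : Fin k) (z : ℂ) :
    (branch p i z).im = -p.2 i * z.im + (1 + p.2 i) * (p.1 i).im := by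
  simp [branch]

lemma branch_sub_branch (p : (Fin k → ℂ) × (Fin k → ℝ)) (i : Fin k) (z z' : ℂ) :
    branch p i z - branch p i z' = -(p.2 i : ℂ) * (z - z') := by
  simp only [branch]; ring

lemma cone_unique (hi : z ∈ cone w i) (hj : z ∈ cone w j) : i = j := by
  by_contra h
  have h1 := hi j (Ne.symm h)
  have h2 := hj i h
  simp only [cross] at h1 h2
  linarith

lemma billiardMap_eq_branch (h : z ∈ cone p.1 i) : billiardMap p z = branch p i z := by
  have hex : ∃ i, z ∈ cone p.1 i := ⟨i, h⟩
  have : hex.choose = i := cone_unique hex.choose_spec h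
  rw [billiardMap, dif_pos hex, this, branch]

/-- The cross product is affine in `x` and positive at every vertex but `w i`, so a convex
combination where it vanishes has all its weight on `w i`. -/
lemma eq_vertex_of_mem_polygon (hz : z ∈ cone w i) (hx : x ∈ polygon w)
    (h : cross (w i - z) (x - z) = 0) : x = w i := by
  rw [polygon, convexHull_range_eq_exists_affineCombination] at hx
  obtain ⟨s, c, hc, hc1, rfl⟩ := hx
  rw [Finset.affineCombination_eq_linear_combination _ _ _ hc1] at h ⊢
  have key : cross (w i - z) (∑ a ∈ s, c a • w a - z)
      = ∑ a ∈ s, c a * cross (w i - z) (w a - z) := by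
    have : (∑ a ∈ s, c a • w a - z) = ∑ a ∈ s, c a • (w a - z) := by
      simp only [smul_sub, Finset.sum_sub_distrib, ← Finset.sum_smul, hc1, one_smul]
    rw [this]
    simp only [cross, Complex.re_sum, Complex.im_sum, Finset.mul_sum, ← Finset.sum_sub_distrib]
    refine Finset.sum_congr rfl fun a _ => ?_
    simp only [Complex.real_smul, Complex.re_ofReal_mul, Complex.im_ofReal_mul]
    ring
  rw [key] at h
  have hnn : ∀ a ∈ s, 0 ≤ c a * cross (w i - z) (w a - z) := by
    intro a ha
    by_cases hai : a = i
    · subst hai; simp [cross, mul_comm]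
    · exact mul_nonneg (hc a ha) (hz a hai).le
  have h0 := (Finset.sum_eq_zero_iff_of_nonneg hnn).1 h
  have hz0 : ∀ a ∈ s, a ≠ i → c a = 0 := fun a ha hai =>
    (mul_eq_zero.1 (h0 a ha)).resolve_right (hz a hai).ne'
  have : ∑ a ∈ s, c a • w a = ∑ a ∈ s, c a • w i := by
    refine Finset.sum_congr rfl fun a ha => ?_
    by_cases hai : a = i
    · rw [hai]
    · simp [hz0 a ha hai]
  rw [this, ← Finset.sum_smul, hc1, one_smul]

lemma ne_vertex_of_mem_cone (hk : 2 ≤ k) (hz : z ∈ cone w i) : z ≠ w i := by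
  rintro rfl
  have : Nontrivial (Fin k) := Fin.nontrivial_iff_two_le.2 hk
  obtain ⟨j, hj⟩ := exists_ne i
  have := hz j hj
  simp [cross] at this

lemma notMem_polygon_of_mem_cone (hk : 2 ≤ k) (hz : z ∈ cone w i) : z ∉ polygon w := fun h =>
  ne_vertex_of_mem_cone hk hz (eq_vertex_of_mem_polygon hz h (by simp [cross]))

lemma branch_notMem_polygon (hk : 2 ≤ k) (hp : 0 < p.2 i) (hz : z ∈ cone p.1 i) :
    branch p i z ∉ polygon p.1 := by
  intro h
  have h1 := eq_vertex_of_mem_polygon hz h (by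
    simp only [cross, Complex.sub_re, Complex.sub_im, branch_re, branch_im]; ring)
  have h2 : (p.2 i : ℂ) * (p.1 i - z) = 0 := by
    simp only [branch] at h1; linear_combination h1
  rcases mul_eq_zero.1 h2 with h3 | h3
  · exact hp.ne' (by exact_mod_cast h3)
  · exact ne_vertex_of_mem_cone hk hz (sub_eq_zero.1 h3).symm

/-- Passing through `w i` reverses the sign of the defining cross products. The resulting ban on
repeated symbols survives limits, and it excludes spurious weak orbits such as the one resting at a
vertex. -/
lemma branch_notMem_cone (hk : 2 ≤ k) (hp : 0 < p.2 i) (hz : z ∈ cone p.1 i) :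
    branch p i z ∉ cone p.1 i := by
  intro h
  have : Nontrivial (Fin k) := Fin.nontrivial_iff_two_le.2 hk
  obtain ⟨j, hj⟩ := exists_ne i
  have h1 := hz j hj
  have h2 := h j hj
  have : cross (p.1 i - branch p i z) (p.1 j - branch p i z)
      = -(p.2 i * cross (p.1 i - z) (p.1 j - z)) := by
    simp only [cross, Complex.sub_re, Complex.sub_im, branch_re, branch_im]; ring
  rw [this] at h2
  have := mul_pos hp h1
  linarith

lemma notMem_singularSet_of_mem_cone [NeZero k] (hw : IsConvexPolygon w) (hz : z ∈ cone w i) :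
    z ∉ singularSet w := by
  rintro ⟨-, a, t, ht, rfl⟩
  have hne : a + 1 ≠ a := by
    obtain ⟨n, rfl⟩ : ∃ n, k = n + 2 := ⟨k - 2, by have := hw.1; omega⟩
    simp
  by_cases hia : i = a
  · subst hia
    have := hz _ hne
    simp only [cross, Complex.sub_re, Complex.sub_im, Complex.add_re, Complex.add_im,
      Complex.re_ofReal_mul, Complex.im_ofReal_mul] at this
    nlinarith
  by_cases hia' : i = a + 1
  · subst hia'
    have := hz _ hne.symm
    simp only [cross, Complex.sub_re, Complex.sub_im, Complex.add_re, Complex.add_im,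
      Complex.re_ofReal_mul, Complex.im_ofReal_mul] at this
    nlinarith
  -- For `i = a` or `i = a + 1` a cross product vanished by collinearity; any other `w i` is
  -- strictly left of the side, so `w a` is to the right of the ray from `z` to `w i`.
  have h1 := hw.2 a i hia hia'
  have h2 := hz a (Ne.symm hia)
  have : cross (w i - (w a + t * (w a - w (a + 1)))) (w a - (w a + t * (w a - w (a + 1))))
      = -(t * cross (w (a + 1) - w a) (w i - w a)) := by
    simp only [cross, Complex.sub_re, Complex.sub_im, Complex.add_re, Complex.add_im,
      Complex.re_ofReal_mul, Complex.im_ofReal_mul]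
    ring
  rw [this] at h2
  have := mul_pos ht h1
  linarith

lemma isCompact_polygon (w : Fin k → ℂ) : IsCompact (polygon w) :=
  (Set.finite_range w).isCompact_convexHull ℝ

/-- Outside the polygon and the singular set the tangent ray touches exactly one vertex. -/
lemma exists_mem_cone [NeZero k] (hw : IsConvexPolygon w) (hz : z ∉ polygon w)
    (hs : z ∉ singularSet w) : ∃ i, z ∈ cone w i := by
  obtain ⟨f, u, hfz, hf⟩ := geometric_hahn_banach_point_closed (convex_convexHull ℝ (range w))
    (isCompact_polygon w).isClosed hz
  have hpos : ∀ j, 0 < f (w j - z) := fun j => by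
    rw [map_sub]
    have := hf (w j) (subset_convexHull ℝ _ (mem_range_self j))
    linarith
  have hfv : ∀ v : ℂ, f v = v.re * f 1 + v.im * f Complex.I := fun v => by
    conv_lhs => rw [← Complex.re_add_im v]
    rw [map_add, mul_comm (v.im : ℂ), show (v.re : ℂ) = v.re • (1 : ℂ) by simp,
      show Complex.I * (v.im : ℂ) = v.im • Complex.I by simp [mul_comm], map_smul, map_smul]
    simp
  set α := f 1
  set β := f Complex.I
  have hαβ : 0 < α ^ 2 + β ^ 2 := by
    have h := hpos 0
    rw [hfv] at h
    by_contra hn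
    have h1 : α = 0 := by nlinarith [sq_nonneg α, sq_nonneg β]
    have h2 : β = 0 := by nlinarith [sq_nonneg α, sq_nonneg β]
    rw [h1, h2] at h
    simp at h
  let g : ℂ → ℝ := fun v => α * v.im - β * v.re
  have hcross : ∀ v v' : ℂ, (α ^ 2 + β ^ 2) * cross v v' = f v * g v' - g v * f v' := by
    intro v v'
    simp only [hfv, g, cross]; ring
  -- Seen from `z` all vertices lie in the half-plane `f > 0`; the least slope `g / f` is the
  -- rightmost direction, that of the tangent ray.
  obtain ⟨i, hi⟩ := Finite.exists_min fun j => g (w j - z) / f (w j - z)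
  have hle : ∀ j, 0 ≤ cross (w i - z) (w j - z) := by
    intro j
    have h1 := (div_le_div_iff₀ (hpos i) (hpos j)).1 (hi j)
    have h2 := hcross (w i - z) (w j - z)
    by_contra hn
    nlinarith
  -- Two vertices on the tangent ray, `w a` the nearer: either they span a side and `z` is singular,
  -- or `w (a + 1)` is on the wrong side of the ray.
  have hedge : ∀ a b : Fin k, b ≠ a → (∀ j, 0 ≤ cross (w a - z) (w j - z)) →
      ∀ t : ℝ, 1 < t → w b - z = t • (w a - z) → False := by
    intro a b hba ha t ht hab
    rw [Complex.ext_iff] at hab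
    simp only [Complex.real_smul, Complex.re_ofReal_mul, Complex.im_ofReal_mul, Complex.sub_re,
      Complex.sub_im] at hab
    by_cases hb : b = a + 1
    · refine hs ⟨hz, a, 1 / (t - 1), by apply one_div_pos.2; linarith, ?_⟩
      have ht0 : t - 1 ≠ 0 := by linarith
      rw [← hb]
      apply Complex.ext
      · simp only [Complex.add_re, Complex.re_ofReal_mul, Complex.sub_re]
        field_simp
        linarith [hab.1]
      · simp only [Complex.add_im, Complex.im_ofReal_mul, Complex.sub_im]
        field_simp
        linarith [hab.2]
    · have h1 := hw.2 a b hba hb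
      have h2 := ha (a + 1)
      have h3 : cross (w (a + 1) - w a) (w b - w a)
          = -((t - 1) * cross (w a - z) (w (a + 1) - z)) := by
        have e1 : (w b).re = z.re + t * ((w a).re - z.re) := by linarith [hab.1]
        have e2 : (w b).im = z.im + t * ((w a).im - z.im) := by linarith [hab.2]
        simp only [cross, Complex.sub_re, Complex.sub_im, e1, e2]
        ring
      rw [h3] at h1
      have := mul_nonneg (sub_nonneg.2 ht.le) h2
      linarith
  refine ⟨i, fun j hj => lt_of_le_of_ne (hle j) fun h0 => ?_⟩
  have hfi := hpos i
  have hfj := hpos j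
  have hfi' := hfv (w i - z)
  have hfj' := hfv (w j - z)
  have hpar : f (w i - z) • (w j - z) = f (w j - z) • (w i - z) := by
    simp only [cross] at h0
    apply Complex.ext
    · simp only [Complex.real_smul, Complex.re_ofReal_mul, hfi', hfj']
      linear_combination β * h0
    · simp only [Complex.real_smul, Complex.im_ofReal_mul, hfi', hfj']
      linear_combination -α * h0
  have hji : w j - z = (f (w j - z) / f (w i - z)) • (w i - z) := by
    rw [div_eq_inv_mul, mul_smul, ← hpar, smul_smul, inv_mul_cancel₀ hfi.ne', one_smul]
  have hij : w i - z = (f (w i - z) / f (w j - z)) • (w j - z) := by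
    rw [div_eq_inv_mul, mul_smul, hpar, smul_smul, inv_mul_cancel₀ hfj.ne', one_smul]
  rcases lt_trichotomy (f (w i - z)) (f (w j - z)) with h | h | h
  · exact hedge i j hj hle _ ((one_lt_div hfi).2 h) hji
  · rw [h, div_self hfj.ne', one_smul] at hji
    have hwij : w j = w i := by linear_combination hji
    by_cases hji1 : j = i + 1
    · obtain ⟨b, hb1, hb2⟩ : ∃ b : Fin k, b ≠ i ∧ b ≠ i + 1 := by
        have h3 := hw.1
        have : ({i, i + 1} : Finset (Fin k)) ≠ Finset.univ := by
          intro he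
          have hc := Finset.card_le_two (a := i) (b := i + 1)
          rw [he, Finset.card_univ, Fintype.card_fin] at hc
          omega
        by_contra hcon
        push Not at hcon
        refine this (Finset.eq_univ_of_forall fun b => ?_)
        by_cases hbi : b = i
        · simp [hbi]
        · simp [hcon b hbi]
      have := hw.2 i b hb1 hb2
      rw [← hji1, hwij] at this
      simp [cross] at this
    · have := hw.2 i j hj hji1
      rw [hwij] at this
      simp [cross] at this
  · refine hedge j i hj.symm (fun a => ?_) _ ((one_lt_div hfj).2 h) hij
    have h4 := hle a
    rw [hij] at h4
    have : cross ((f (w i - z) / f (w j - z)) • (w j - z)) (w a - z)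
        = (f (w i - z) / f (w j - z)) * cross (w j - z) (w a - z) := by
      simp only [cross, Complex.real_smul, Complex.re_ofReal_mul, Complex.im_ofReal_mul]; ring
    rw [this] at h4
    exact (mul_nonneg_iff_of_pos_left (div_pos hfi hfj)).1 h4

/-- The orbit of a non-singular point stays in the cones. -/
lemma NonSingular.exists_mem_cone [NeZero k] (hp : p ∈ Params k) (hz : NonSingular p z) :
    ∃ i, z ∈ cone p.1 i :=
  OuterBilliard.exists_mem_cone hp.1 hz.1 (hz.2 0)

lemma NonSingular.map [NeZero k] (hp : p ∈ Params k) (hz : NonSingular p z) :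
    NonSingular p (billiardMap p z) := by
  obtain ⟨i, hi⟩ := hz.exists_mem_cone hp
  refine ⟨?_, fun n => ?_⟩
  · rw [billiardMap_eq_branch hi]
    exact branch_notMem_polygon (by have := hp.1.1; omega) (hp.2.2 i).1 hi
  · rw [← Function.iterate_succ_apply]
    exact hz.2 (n + 1)

lemma NonSingular.iterate [NeZero k] (hp : p ∈ Params k) (hz : NonSingular p z) (n : ℕ) :
    NonSingular p ((billiardMap p)^[n] z) := by
  induction n with
  | zero => exact hz
  | succ n ih => rw [Function.iterate_succ_apply']; exact ih.map hp

lemma nonSingular_of_forall_mem_cone [NeZero k] (hp : p ∈ Params k)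
    (h : ∀ n, ∃ i, (billiardMap p)^[n] z ∈ cone p.1 i) : NonSingular p z := by
  refine ⟨?_, fun n => ?_⟩
  · obtain ⟨i, hi⟩ := h 0
    exact notMem_polygon_of_mem_cone (by have := hp.1.1; omega) hi
  · obtain ⟨i, hi⟩ := h n
    exact notMem_singularSet_of_mem_cone hp.1 hi

end OuterBilliard

/-! ### Continuation of periodic orbits, and what a model implies. -/

namespace OuterBilliard

section Tracking

variable {X : Type*} [MetricSpace X] {T T₀ : X → X} {Q : Set X} {r μ : ℝ}

lemma iterate_tracking (hμ : 0 ≤ μ) (hQ : MapsTo T₀ Q Q)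
    (hball : ∀ ζ ∈ Q, MapsTo T (Metric.closedBall ζ r) (Metric.closedBall (T₀ ζ) r))
    (hcon : ∀ ζ ∈ Q, ∀ x ∈ Metric.closedBall ζ r, ∀ y ∈ Metric.closedBall ζ r,
      dist (T x) (T y) ≤ μ * dist x y) (n : ℕ) :
    ∀ ζ ∈ Q, MapsTo T^[n] (Metric.closedBall ζ r) (Metric.closedBall (T₀^[n] ζ) r) ∧
      ∀ x ∈ Metric.closedBall ζ r, ∀ y ∈ Metric.closedBall ζ r,
        dist (T^[n] x) (T^[n] y) ≤ μ ^ n * dist x y := by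
  induction n with
  | zero => exact fun ζ _ => ⟨fun x hx => hx, fun x _ y _ => by simp⟩
  | succ n ih =>
    intro ζ hζ
    obtain ⟨h1, h2⟩ := ih _ (hQ hζ)
    refine ⟨fun x hx => ?_, fun x hx y hy => ?_⟩
    · rw [Function.iterate_succ_apply, Function.iterate_succ_apply]
      exact h1 (hball ζ hζ hx)
    · rw [Function.iterate_succ_apply, Function.iterate_succ_apply]
      refine (h2 _ (hball ζ hζ hx) _ (hball ζ hζ hy)).trans ?_
      rw [pow_succ, mul_assoc]
      exact mul_le_mul_of_nonneg_left (hcon ζ hζ x hx y hy) (pow_nonneg hμ n)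

/-- A map that contracts neighbourhoods of the points of finitely many periodic orbits and tracks
them has a conjugate copy of these orbits. -/
theorem exists_tracking_orbits [CompleteSpace X] (hr : 0 ≤ r) (hμ : 0 ≤ μ) (hμ1 : μ < 1)
    (hQ : MapsTo T₀ Q Q) (hper : Q ⊆ Function.periodicPts T₀)
    (hball : ∀ ζ ∈ Q, MapsTo T (Metric.closedBall ζ r) (Metric.closedBall (T₀ ζ) r))
    (hcon : ∀ ζ ∈ Q, ∀ x ∈ Metric.closedBall ζ r, ∀ y ∈ Metric.closedBall ζ r,
      dist (T x) (T y) ≤ μ * dist x y) :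
    ∃ φ : X → X, (∀ ζ ∈ Q, φ ζ ∈ Metric.closedBall ζ r) ∧ ∀ ζ ∈ Q, T (φ ζ) = φ (T₀ ζ) := by
  have hex : ∀ ζ ∈ Q, ∃ y ∈ Metric.closedBall ζ r, y ∈ Function.periodicPts T := by
    intro ζ hζ
    obtain ⟨n, hn, hnζ⟩ := hper hζ
    -- After a full period the ball returns into itself, so Banach's fixed point theorem applies to
    -- `T^[n]`.
    obtain ⟨h1, h2⟩ := iterate_tracking hμ hQ hball hcon n ζ hζ
    rw [hnζ.eq] at h1
    have hc : ContractingWith ⟨μ ^ n, pow_nonneg hμ n⟩ (h1.restrict T^[n] _ _) := by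
      refine ⟨?_, LipschitzWith.of_dist_le_mul fun x y => h2 _ x.2 _ y.2⟩
      exact NNReal.coe_lt_coe.1 (pow_lt_one₀ hμ hμ1 hn.ne')
    obtain ⟨y, hy, hfix, -⟩ := hc.exists_fixedPoint' Metric.isClosed_closedBall.isComplete h1
      (Metric.mem_closedBall_self hr) (edist_ne_top _ _)
    exact ⟨y, hy, n, hn, hfix⟩
  have huniq : ∀ ζ ∈ Q, ∀ x ∈ Metric.closedBall ζ r, ∀ y ∈ Metric.closedBall ζ r,
      x ∈ Function.periodicPts T → y ∈ Function.periodicPts T → x = y := by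
    rintro ζ hζ x hx y hy ⟨m, hm, hmx⟩ ⟨n, hn, hny⟩
    -- `m * n` is a common period, so the contraction forces the distance to be zero; this
    -- uniqueness yields the conjugacy.
    have h2 := (iterate_tracking hμ hQ hball hcon (m * n) ζ hζ).2 x hx y hy
    rw [(hmx.mul_const n).eq, (hny.const_mul m).eq] at h2
    have hlt : μ ^ (m * n) < 1 := pow_lt_one₀ hμ hμ1 (Nat.mul_pos hm hn).ne'
    by_contra hne
    nlinarith [dist_pos.2 hne]
  classical
  refine ⟨fun ζ => if h : ζ ∈ Q then (hex ζ h).choose else ζ, fun ζ hζ => ?_, fun ζ hζ => ?_⟩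
  · simp only [dif_pos hζ]
    exact (hex ζ hζ).choose_spec.1
  · simp only [dif_pos hζ, dif_pos (hQ hζ)]
    have h1 := (hex ζ hζ).choose_spec
    have h2 := (hex _ (hQ hζ)).choose_spec
    refine huniq _ (hQ hζ) _ (hball ζ hζ h1.1) _ h2.1 ?_ h2.2
    obtain ⟨n, hn, hnx⟩ := h1.2
    exact ⟨n, hn, hnx.map (Function.Commute.refl T)⟩

end Tracking

/-- The non-singular dynamics of `p` is asymptotic to the finite set `φ '' Q` of periodic points,
on which the billiard map is conjugate to the map `T₀` on `Q`. -/
structure IsModel {k : ℕ} [NeZero k] (p : (Fin k → ℂ) × (Fin k → ℝ)) (T₀ : ℂ → ℂ) (Q : Set ℂ)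
    (φ : ℂ → ℂ) : Prop where
  finite : Q.Finite
  mapsTo : MapsTo T₀ Q Q
  periodic : Q ⊆ Function.periodicPts T₀
  injOn : InjOn φ Q
  conj : ∀ ζ ∈ Q, billiardMap p (φ ζ) = φ (T₀ ζ)
  nonSingular : ∀ ζ ∈ Q, NonSingular p (φ ζ)
  attracts : ∀ z, NonSingular p z → ∃ ζ ∈ Q, ∃ K : ℕ,
    Tendsto (fun n => dist ((billiardMap p)^[n + K] z) (φ (T₀^[n] ζ))) atTop (𝓝 0)

namespace IsModel

variable {k : ℕ} [NeZero k] {p : (Fin k → ℂ) × (Fin k → ℝ)} {T₀ : ℂ → ℂ} {Q Γ : Set ℂ} {φ : ℂ → ℂ}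
  {ζ z : ℂ}

lemma iterate_mem (h : IsModel p T₀ Q φ) (hζ : ζ ∈ Q) (n : ℕ) : T₀^[n] ζ ∈ Q :=
  h.mapsTo.iterate n hζ

lemma iterate_conj (h : IsModel p T₀ Q φ) (hζ : ζ ∈ Q) (n : ℕ) :
    (billiardMap p)^[n] (φ ζ) = φ (T₀^[n] ζ) := by
  induction n with
  | zero => rfl
  | succ n ih =>
    rw [Function.iterate_succ_apply', ih, h.conj _ (h.iterate_mem hζ n),
      Function.iterate_succ_apply']

lemma range_iterate (h : IsModel p T₀ Q φ) (hζ : ζ ∈ Q) :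
    range (fun n : ℕ => (billiardMap p)^[n] (φ ζ)) = φ '' range (fun n : ℕ => T₀^[n] ζ) := by
  rw [← range_comp]
  exact congrArg range (funext fun n => h.iterate_conj hζ n)

lemma isPeriodicPt_iff (h : IsModel p T₀ Q φ) (hζ : ζ ∈ Q) (n : ℕ) :
    Function.IsPeriodicPt (billiardMap p) n (φ ζ) ↔ Function.IsPeriodicPt T₀ n ζ := by
  rw [Function.IsPeriodicPt, Function.IsFixedPt, h.iterate_conj hζ,
    h.injOn.eq_iff (h.iterate_mem hζ n) hζ]
  rfl

lemma minimalPeriod_eq (h : IsModel p T₀ Q φ) (hζ : ζ ∈ Q) :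
    Function.minimalPeriod (billiardMap p) (φ ζ) = Function.minimalPeriod T₀ ζ :=
  Nat.dvd_antisymm
    (((h.isPeriodicPt_iff hζ _).2 (Function.isPeriodicPt_minimalPeriod _ _)).minimalPeriod_dvd)
    (((h.isPeriodicPt_iff hζ _).1 (Function.isPeriodicPt_minimalPeriod _ _)).minimalPeriod_dvd)

lemma mem_limitSet_of_isPeriodicPt {n : ℕ} (hz : NonSingular p z) (hn : 0 < n)
    (hnz : (billiardMap p)^[n] z = z) : z ∈ limitSet p := by
  rw [limitSet, mem_iUnion₂]
  refine ⟨z, hz, ?_⟩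
  rw [mem_omegaLimit_singleton_iff_mapClusterPt, mapClusterPt_iff_frequently]
  intro s hs
  rw [frequently_atTop]
  intro a
  refine ⟨n * a, Nat.le_mul_of_pos_left a hn, ?_⟩
  have : Function.IsPeriodicPt (billiardMap p) (n * a) z :=
    Function.IsPeriodicPt.mul_const (m := n) hnz a
  rw [this.eq]
  exact mem_of_mem_nhds hs

theorem limitSet_eq (h : IsModel p T₀ Q φ) : limitSet p = φ '' Q := by
  apply Subset.antisymm
  · intro y hy
    rw [limitSet, mem_iUnion₂] at hy
    obtain ⟨z, hz, hy⟩ := hy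
    rw [mem_omegaLimit_singleton_iff_mapClusterPt, mapClusterPt_iff_frequently] at hy
    obtain ⟨ζ, hζ, K, hK⟩ := h.attracts z hz
    rw [← (h.finite.image φ).isClosed.closure_eq, Metric.mem_closure_iff]
    intro ε hε
    have h1 : ∀ᶠ n in atTop, dist ((billiardMap p)^[n + K] z) (φ (T₀^[n] ζ)) < ε / 2 :=
      hK.eventually (gt_mem_nhds (half_pos hε))
    obtain ⟨N, hN⟩ := eventually_atTop.1 h1
    obtain ⟨n, hn, hn'⟩ := frequently_atTop.1 (hy _ (Metric.ball_mem_nhds y (half_pos hε))) (N + K)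
    obtain ⟨m, rfl⟩ : ∃ m, n = m + K := ⟨n - K, by omega⟩
    refine ⟨_, mem_image_of_mem φ (h.iterate_mem hζ m), ?_⟩
    have h2 := hN m (by omega)
    rw [Metric.mem_ball, dist_comm] at hn'
    linarith [dist_triangle y ((billiardMap p)^[m + K] z) (φ (T₀^[m] ζ))]
  · rintro _ ⟨ζ, hζ, rfl⟩
    obtain ⟨n, hn, hnζ⟩ := h.periodic hζ
    exact mem_limitSet_of_isPeriodicPt (h.nonSingular ζ hζ) hn ((h.isPeriodicPt_iff hζ n).2 hnζ)

/-- Periodic points are recurrent, so by `limitSet_eq` none exist outside `φ '' Q`. -/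
theorem isPeriodicOrbit_iff (h : IsModel p T₀ Q φ) :
    IsPeriodicOrbit p Γ ↔ ∃ ζ ∈ Q, Γ = φ '' range (fun n : ℕ => T₀^[n] ζ) := by
  constructor
  · rintro ⟨z, hz, ⟨n, hn, hnz⟩, rfl⟩
    have hmem := mem_limitSet_of_isPeriodicPt hz hn hnz
    rw [h.limitSet_eq] at hmem
    obtain ⟨ζ, hζ, rfl⟩ := hmem
    exact ⟨ζ, hζ, h.range_iterate hζ⟩
  · rintro ⟨ζ, hζ, rfl⟩
    obtain ⟨n, hn, hnζ⟩ := h.periodic hζ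
    exact ⟨φ ζ, h.nonSingular ζ hζ, ⟨n, hn, (h.isPeriodicPt_iff hζ n).2 hnζ⟩,
      (h.range_iterate hζ).symm⟩

theorem asymptoticallyPeriodic (h : IsModel p T₀ Q φ) : AsymptoticallyPeriodic p := by
  refine ⟨(fun ζ => φ '' range (fun n : ℕ => T₀^[n] ζ)) '' Q, h.finite.image _, ?_, ?_, ?_⟩
  · rintro _ ⟨ζ, hζ, rfl⟩
    exact h.isPeriodicOrbit_iff.2 ⟨ζ, hζ, rfl⟩
  · rw [h.limitSet_eq]
    apply Subset.antisymm
    · rintro _ ⟨ζ, hζ, rfl⟩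
      exact ⟨_, mem_image_of_mem _ hζ, mem_image_of_mem φ ⟨0, rfl⟩⟩
    · rintro _ ⟨_, ⟨ζ, hζ, rfl⟩, _, ⟨n, rfl⟩, rfl⟩
      exact mem_image_of_mem φ (h.iterate_mem hζ n)
  · intro z hz
    obtain ⟨ζ, hζ, K, hK⟩ := h.attracts z hz
    refine ⟨_, mem_image_of_mem _ hζ, ?_⟩
    rw [← tendsto_add_atTop_iff_nat K]
    exact squeeze_zero (fun _ => Metric.infDist_nonneg)
      (fun n => Metric.infDist_le_dist_of_mem (mem_image_of_mem φ ⟨n, rfl⟩)) hK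

end IsModel

end OuterBilliard

/-! ### Weak orbits and compactness. -/

namespace OuterBilliard

/-- A weak orbit: a sequence of points with an itinerary, such that each point lies in the closed
cone of its symbol and is mapped by the corresponding branch, and no symbol is repeated. -/
def IsWeakOrbit {k : ℕ} (p : (Fin k → ℂ) × (Fin k → ℝ)) (f : ℕ → ℂ × Fin k) : Prop :=
  ∀ n, (∀ j, 0 ≤ cross (p.1 (f n).2 - (f n).1) (p.1 j - (f n).1)) ∧
    (f (n + 1)).2 ≠ (f n).2 ∧ (f (n + 1)).1 = branch p (f n).2 (f n).1

variable {k : ℕ}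

lemma isOpen_setOf_mem_cone (i : Fin k) :
    IsOpen {q : ((Fin k → ℂ) × (Fin k → ℝ)) × ℂ | q.2 ∈ cone q.1.1 i} := by
  have heq : {q : ((Fin k → ℂ) × (Fin k → ℝ)) × ℂ | q.2 ∈ cone q.1.1 i} =
      ⋂ j ∈ {j | j ≠ i}, {q | 0 < cross (q.1.1 i - q.2) (q.1.1 j - q.2)} := by
    ext q; simp [cone]
  rw [heq]
  refine (toFinite _).isOpen_biInter fun j _ => ?_
  refine isOpen_lt continuous_const (continuous_cross.comp (f := fun q :
    ((Fin k → ℂ) × (Fin k → ℝ)) × ℂ => (q.1.1 i - q.2, q.1.1 j - q.2)) ?_)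
  fun_prop

lemma continuous_branch (i : Fin k) :
    Continuous fun q : ((Fin k → ℂ) × (Fin k → ℝ)) × ℂ => branch q.1 i q.2 := by
  unfold branch
  fun_prop

/-- Symbols are discrete, so each is locally constant; once it is fixed, only weak inequalities and
equations between continuous functions remain. -/
lemma isClosed_setOf_isWeakOrbit :
    IsClosed {q : ((Fin k → ℂ) × (Fin k → ℝ)) × (ℕ → ℂ × Fin k) | IsWeakOrbit q.1 q.2} := by
  have hsymb : ∀ n (i : Fin k),
      IsOpen {q : ((Fin k → ℂ) × (Fin k → ℝ)) × (ℕ → ℂ × Fin k) | (q.2 n).2 = i} := fun n i =>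
    (isOpen_discrete {i}).preimage (f := fun q :
      ((Fin k → ℂ) × (Fin k → ℝ)) × (ℕ → ℂ × Fin k) => (q.2 n).2) (by fun_prop)
  have heq : {q : ((Fin k → ℂ) × (Fin k → ℝ)) × (ℕ → ℂ × Fin k) | IsWeakOrbit q.1 q.2} =
      ⋂ n, ⋂ i : Fin k, {q | (q.2 n).2 = i → q ∈
        (⋂ j, {q | 0 ≤ cross (q.1.1 i - (q.2 n).1) (q.1.1 j - (q.2 n).1)}) ∩
          ({q | (q.2 (n + 1)).2 = i}ᶜ ∩ {q | (q.2 (n + 1)).1 = branch q.1 i (q.2 n).1})} := by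
    ext q
    simp [IsWeakOrbit]
  rw [heq]
  refine isClosed_iInter fun n => isClosed_iInter fun i => isClosed_imp (hsymb n i) ?_
  refine IsClosed.inter (isClosed_iInter fun j => isClosed_le continuous_const ?_)
    (IsClosed.inter (hsymb (n + 1) i).isClosed_compl (isClosed_eq (by fun_prop) ?_))
  · refine continuous_cross.comp (f := fun q :
      ((Fin k → ℂ) × (Fin k → ℝ)) × (ℕ → ℂ × Fin k) =>
        (q.1.1 i - (q.2 n).1, q.1.1 j - (q.2 n).1)) ?_
    fun_prop
  · refine (continuous_branch i).comp (f := fun q :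
      ((Fin k → ℂ) × (Fin k → ℝ)) × (ℕ → ℂ × Fin k) => (q.1, (q.2 n).1)) ?_
    fun_prop

/-- If all weak orbits of `p₀` visit the open set `V`, then so do the bounded weak orbits of all
nearby parameters. -/
theorem eventually_forall_isWeakOrbit_exists_mem (p₀ : (Fin k → ℂ) × (Fin k → ℝ)) {V : Set ℂ}
    (hV : IsOpen V) (h : ∀ f, IsWeakOrbit p₀ f → ∃ n, (f n).1 ∈ V) (R : ℝ) :
    ∀ᶠ p in 𝓝 p₀, ∀ f, IsWeakOrbit p f → (∀ n, ‖(f n).1‖ ≤ R) → ∃ n, (f n).1 ∈ V := by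
  let Y := ℕ → Metric.closedBall (0 : ℂ) R × Fin k
  have : CompactSpace (Metric.closedBall (0 : ℂ) R) :=
    isCompact_iff_compactSpace.1 (isCompact_closedBall 0 R)
  let g : Y → ℕ → ℂ × Fin k := fun y n => ((y n).1, (y n).2)
  have hg : Continuous g := by fun_prop
  let E : Set (((Fin k → ℂ) × (Fin k → ℝ)) × Y) :=
    {q | IsWeakOrbit q.1 (g q.2)} ∩ ⋂ n, {q | (g q.2 n).1 ∈ Vᶜ}
  have hE : IsClosed E := by
    refine IsClosed.inter (isClosed_setOf_isWeakOrbit.preimage (f := fun q :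
      ((Fin k → ℂ) × (Fin k → ℝ)) × Y => (q.1, g q.2)) (by fun_prop)) ?_
    exact isClosed_iInter fun n => hV.isClosed_compl.preimage (f := fun q :
      ((Fin k → ℂ) × (Fin k → ℝ)) × Y => (g q.2 n).1) (by fun_prop)
  -- `Y` is compact by Tychonoff, so the parameters with a bounded weak orbit avoiding `V` form a
  -- closed set.
  have hcl := isClosedMap_fst_of_compactSpace E hE
  have hp₀ : p₀ ∉ Prod.fst '' E := by
    rintro ⟨⟨p, y⟩, ⟨h1, h2⟩, rfl⟩
    obtain ⟨n, hn⟩ := h _ h1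
    exact mem_iInter.1 h2 n hn
  filter_upwards [hcl.isOpen_compl.mem_nhds hp₀] with p hp f hf hR
  by_contra hcon
  push Not at hcon
  refine hp ⟨(p, fun n => (⟨(f n).1, mem_closedBall_zero_iff.2 (hR n)⟩, (f n).2)), ⟨hf, ?_⟩, rfl⟩
  exact mem_iInter.2 hcon

/-- A uniform contraction rate and an absorbing ball for all nearby parameters. -/
lemma exists_absorbing_ball (p₀ : (Fin k → ℂ) × (Fin k → ℝ)) {μ : ℝ} (hμ : μ < 1) :
    ∃ R, ∀ᶠ p in 𝓝 p₀, (∀ i, |p.2 i| ≤ μ) → ∀ z : ℕ → ℂ,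
      (∀ n, ∃ i, z (n + 1) = branch p i (z n)) → ∃ K, ∀ n, ‖z (n + K)‖ ≤ R := by
  -- With vertices bounded by `M`, norms obey `x ↦ μ * x + 2 * M`, whose fixed point is `2 * M / (1
  -- - μ)`; the final 1 is room for the decaying term.
  refine ⟨2 * (‖p₀.1‖ + 1) / (1 - μ) + 1, ?_⟩
  set M := ‖p₀.1‖ + 1 with hM
  have h1 : ∀ᶠ p in 𝓝 p₀, ‖p.1‖ < M :=
    (continuous_fst.norm.tendsto p₀).eventually (gt_mem_nhds (by simp [hM]))
  filter_upwards [h1] with p hp hp2 z hz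
  have hμ1 : 0 < 1 - μ := by linarith
  have hstep : ∀ n, 0 ≤ μ ∧ ‖z (n + 1)‖ ≤ μ * ‖z n‖ + 2 * M := by
    intro n
    obtain ⟨i, hi⟩ := hz n
    have hl := hp2 i
    have hμ0 : 0 ≤ μ := (abs_nonneg _).trans hl
    have hw : ‖p.1 i‖ ≤ M := (norm_le_pi_norm p.1 i).trans hp.le
    refine ⟨hμ0, ?_⟩
    rw [hi, branch]
    refine (norm_add_le _ _).trans (add_le_add ?_ ?_)
    · rw [norm_mul, norm_neg, Complex.norm_real, Real.norm_eq_abs]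
      exact mul_le_mul_of_nonneg_right hl (norm_nonneg _)
    · rw [norm_mul]
      refine mul_le_mul ?_ hw (norm_nonneg _) (by norm_num)
      refine (norm_add_le _ _).trans ?_
      rw [norm_one, Complex.norm_real, Real.norm_eq_abs]
      linarith
  have hμ0 := (hstep 0).1
  have hM0 : 0 ≤ M := by positivity
  have hbound : ∀ n, ‖z n‖ ≤ μ ^ n * ‖z 0‖ + 2 * M / (1 - μ) := by
    intro n
    induction n with
    | zero => simp only [pow_zero, one_mul]; linarith [div_nonneg (by positivity : 0 ≤ 2 * M) hμ1.le]
    | succ n ih =>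
      have h2 := mul_le_mul_of_nonneg_left ih hμ0
      have h3 : 2 * M / (1 - μ) = μ * (2 * M / (1 - μ)) + 2 * M := by field_simp; ring
      rw [pow_succ]
      nlinarith [(hstep n).2]
  have hlim : Tendsto (fun n => μ ^ n * ‖z 0‖) atTop (𝓝 0) := by
    simpa using (tendsto_pow_atTop_nhds_zero_of_lt_one hμ0 hμ).mul_const ‖z 0‖
  obtain ⟨K, hK⟩ := eventually_atTop.1 (hlim.eventually (gt_mem_nhds one_pos))
  exact ⟨K, fun n => by linarith [hbound (n + K), hK (n + K) (by omega)]⟩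

/-- A non-singular orbit together with its itinerary is a weak orbit. -/
lemma NonSingular.exists_isWeakOrbit [NeZero k] {p : (Fin k → ℂ) × (Fin k → ℝ)} {z : ℂ}
    (hp : p ∈ Params k) (hz : NonSingular p z) :
    ∃ s : ℕ → Fin k, IsWeakOrbit p fun n => ((billiardMap p)^[n] z, s n) := by
  choose s hs using fun n => (hz.iterate hp n).exists_mem_cone hp
  have hk : 2 ≤ k := by have := hp.1.1; omega
  have hstep : ∀ n, (billiardMap p)^[n + 1] z = branch p (s n) ((billiardMap p)^[n] z) := by
    intro n
    rw [Function.iterate_succ_apply', billiardMap_eq_branch (hs n)]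
  refine ⟨s, fun n => ⟨fun j => ?_, fun h => ?_, hstep n⟩⟩
  · by_cases hj : j = s n
    · subst hj; simp [cross, mul_comm]
    · exact (hs n j hj).le
  · have h1 := hs (n + 1)
    change s (n + 1) = s n at h
    rw [hstep n, h] at h1
    exact branch_notMem_cone hk (hp.2.2 _).1 (hs n) h1

end OuterBilliard

/-! ### The stability criterion. -/

namespace OuterBilliard

lemma eventually_closedBall_subset_cone {k : ℕ} {p₀ : (Fin k → ℂ) × (Fin k → ℝ)} {ζ : ℂ}
    {i : Fin k} (h : ζ ∈ cone p₀.1 i) :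
    ∀ᶠ r in 𝓝[>] (0 : ℝ), ∀ᶠ p in 𝓝 p₀, Metric.closedBall ζ r ⊆ cone p.1 i := by
  have h1 := (isOpen_setOf_mem_cone i).mem_nhds (show (p₀, ζ) ∈
    {q : ((Fin k → ℂ) × (Fin k → ℝ)) × ℂ | q.2 ∈ cone q.1.1 i} from h)
  rw [nhds_prod_eq, mem_prod_iff] at h1
  obtain ⟨U, hU, V, hV, hUV⟩ := h1
  obtain ⟨s, hs, hsV⟩ := Metric.mem_nhds_iff.1 hV
  filter_upwards [Ioo_mem_nhdsGT hs] with r hr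
  filter_upwards [hU] with p hp x hx
  exact hUV (mk_mem_prod hp (hsV (Metric.closedBall_subset_ball hr.2 hx)))

variable {k : ℕ} [NeZero k] {p p₀ : (Fin k → ℂ) × (Fin k → ℝ)} {T₀ : ℂ → ℂ} {Q : Set ℂ} {r μ ε : ℝ}

/-- The billiard map of `p` is a contraction near the points of `Q`, where it follows the map `T₀`,
and all non-singular orbits come close to `Q`. -/
structure Tracks (p : (Fin k → ℂ) × (Fin k → ℝ)) (T₀ : ℂ → ℂ) (Q : Set ℂ) (r μ : ℝ) : Prop where
  rate : ∀ i, |p.2 i| ≤ μ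
  cone : ∀ ζ ∈ Q, ∃ i, Metric.closedBall ζ r ⊆ cone p.1 i
  mapsTo : ∀ ζ ∈ Q, MapsTo (billiardMap p) (Metric.closedBall ζ r) (Metric.closedBall (T₀ ζ) r)
  enters : ∀ z, NonSingular p z → ∃ n, ∃ ζ ∈ Q, (billiardMap p)^[n] z ∈ Metric.closedBall ζ r

lemma Tracks.dist_le (h : Tracks p T₀ Q r μ) : ∀ ζ ∈ Q, ∀ x ∈ Metric.closedBall ζ r,
    ∀ y ∈ Metric.closedBall ζ r, dist (billiardMap p x) (billiardMap p y) ≤ μ * dist x y := by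
  intro ζ hζ x hx y hy
  obtain ⟨i, hi⟩ := h.cone ζ hζ
  rw [billiardMap_eq_branch (hi hx), billiardMap_eq_branch (hi hy), dist_eq_norm,
    branch_sub_branch, norm_mul, norm_neg, Complex.norm_real, Real.norm_eq_abs, dist_eq_norm]
  exact mul_le_mul_of_nonneg_right (h.rate i) (norm_nonneg _)

lemma exists_iterate_mem_periodicPts {X : Type*} {T : X → X} {Q : Set X} (hfin : Q.Finite)
    (hQ : MapsTo T Q Q) {x : X} (hx : x ∈ Q) : ∃ n, T^[n] x ∈ Function.periodicPts T := by
  obtain ⟨m, -, n, -, hmn, heq⟩ := infinite_univ.exists_ne_map_eq_of_mapsTo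
    (f := fun n : ℕ => T^[n] x) (fun n _ => hQ.iterate n hx) hfin
  wlog hlt : m < n generalizing m n
  · exact this n m hmn.symm heq.symm (by omega)
  refine ⟨m, n - m, by omega, ?_⟩
  change T^[n - m] (T^[m] x) = T^[m] x
  rw [← Function.iterate_add_apply, Nat.sub_add_cancel hlt.le]
  exact heq.symm

theorem Tracks.isModel (h : Tracks p T₀ Q r μ) (hp : p ∈ Params k) (hμ1 : μ < 1)
    (hfin : Q.Finite) (hQ : MapsTo T₀ Q Q)
    (hsep : ∀ ζ ∈ Q, ∀ ζ' ∈ Q, dist ζ ζ' ≤ 2 * r → ζ = ζ') {φ : ℂ → ℂ}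
    (hφ : ∀ ζ ∈ Q ∩ Function.periodicPts T₀, φ ζ ∈ Metric.closedBall ζ r)
    (hconj : ∀ ζ ∈ Q ∩ Function.periodicPts T₀, billiardMap p (φ ζ) = φ (T₀ ζ)) :
    IsModel p T₀ (Q ∩ Function.periodicPts T₀) φ := by
  have hμ : 0 ≤ μ := (abs_nonneg _).trans (h.rate 0)
  have hperT : MapsTo T₀ (Function.periodicPts T₀) (Function.periodicPts T₀) :=
    fun x ⟨n, hn, hx⟩ => ⟨n, hn, hx.map (Function.Commute.refl T₀)⟩
  have hmaps := hQ.inter_inter hperT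
  have hiter := iterate_tracking hμ hQ h.mapsTo h.dist_le
  refine ⟨hfin.inter_of_left _, hmaps, inter_subset_right, ?_, hconj, ?_, ?_⟩
  · intro ζ hζ ζ' hζ' heq
    refine hsep ζ hζ.1 ζ' hζ'.1 ?_
    have h1 := Metric.mem_closedBall'.1 (hφ ζ hζ)
    have h2 := Metric.mem_closedBall.1 (hφ ζ' hζ')
    rw [← heq] at h2
    linarith [dist_triangle ζ (φ ζ) ζ']
  · intro ζ hζ
    refine nonSingular_of_forall_mem_cone hp fun n => ?_
    obtain ⟨i, hi⟩ := h.cone _ (hQ.iterate n hζ.1)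
    exact ⟨i, hi ((hiter n ζ hζ.1).1 (hφ ζ hζ))⟩
  · intro z hz
    obtain ⟨n, ζ, hζ, hn⟩ := h.enters z hz
    -- The ball entered may belong to a merely preperiodic point; `m` more steps lead to a periodic
    -- one.
    obtain ⟨m, hm⟩ := exists_iterate_mem_periodicPts hfin hQ hζ
    have hζ' : T₀^[m] ζ ∈ Q ∩ Function.periodicPts T₀ := ⟨hQ.iterate m hζ, hm⟩
    refine ⟨_, hζ', m + n, ?_⟩
    have hball := (hiter m ζ hζ).1 hn
    rw [← Function.iterate_add_apply] at hball
    have hφi : ∀ j, (billiardMap p)^[j] (φ (T₀^[m] ζ)) = φ (T₀^[j] (T₀^[m] ζ)) := by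
      intro j
      induction j with
      | zero => rfl
      | succ j ih =>
        rw [Function.iterate_succ_apply', ih, hconj _ (hmaps.iterate j hζ'),
          Function.iterate_succ_apply']
    have hlim : Tendsto (fun j => μ ^ j * dist ((billiardMap p)^[m + n] z) (φ (T₀^[m] ζ))) atTop
        (𝓝 0) := by
      simpa using (tendsto_pow_atTop_nhds_zero_of_lt_one hμ hμ1).mul_const _
    refine squeeze_zero (fun _ => dist_nonneg) (fun j => ?_) hlim
    rw [Function.iterate_add_apply, ← hφi j]
    exact (hiter j _ hζ'.1).2 _ hball _ (hφ _ hζ')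

/-- Sufficient condition for the stability of the asymptotic dynamics: all weak orbits approach a
finite invariant set inside the open cones. -/
theorem eventually_exists_isModel (hp₀ : p₀ ∈ Params k) (hfin : Q.Finite)
    (hQ : MapsTo (billiardMap p₀) Q Q) (hcone : ∀ ζ ∈ Q, ∃ i, ζ ∈ cone p₀.1 i)
    (hweak : ∀ r > 0, ∀ f, IsWeakOrbit p₀ f → ∃ n, ∃ ζ ∈ Q, dist (f n).1 ζ < r) (hε : 0 < ε) :
    IsModel p₀ (billiardMap p₀) (Q ∩ Function.periodicPts (billiardMap p₀)) id ∧
    ∀ᶠ p in 𝓝 p₀, p ∈ Params k → ∃ φ : ℂ → ℂ,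
      IsModel p (billiardMap p₀) (Q ∩ Function.periodicPts (billiardMap p₀)) φ ∧
      ∀ ζ ∈ Q ∩ Function.periodicPts (billiardMap p₀), dist (φ ζ) ζ ≤ ε := by
  set T₀ := billiardMap p₀
  obtain ⟨μ, hμ0, hμ1, hμ⟩ : ∃ μ : ℝ, 0 < μ ∧ μ < 1 ∧ ∀ i, |p₀.2 i| < μ := by
    obtain ⟨i, hi⟩ := Finite.exists_max p₀.2
    have := hp₀.2.2 i
    refine ⟨(p₀.2 i + 1) / 2, by linarith [this.1], by linarith [this.2], fun j => ?_⟩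
    rw [abs_of_pos (hp₀.2.2 j).1]
    linarith [hi j, this.2]
  have hcone' : ∀ᶠ r in 𝓝[>] (0 : ℝ), ∀ ζ ∈ Q, ∃ i, ζ ∈ cone p₀.1 i ∧
      ∀ᶠ p in 𝓝 p₀, Metric.closedBall ζ r ⊆ cone p.1 i := by
    rw [hfin.eventually_all]
    intro ζ hζ
    obtain ⟨i, hi⟩ := hcone ζ hζ
    filter_upwards [eventually_closedBall_subset_cone hi] with r hr
    exact ⟨i, hi, hr⟩
  have hsep' : ∀ᶠ r in 𝓝[>] (0 : ℝ), ∀ ζ ∈ Q, ∀ ζ' ∈ Q, dist ζ ζ' ≤ 2 * r → ζ = ζ' := by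
    rw [hfin.eventually_all]
    intro ζ hζ
    rw [hfin.eventually_all]
    intro ζ' hζ'
    by_cases h : ζ = ζ'
    · exact Eventually.of_forall fun _ _ => h
    · filter_upwards [Ioo_mem_nhdsGT (half_pos (dist_pos.2 h))] with r hr hd
      linarith [hr.2]
  obtain ⟨r, ⟨⟨hcr, hsep⟩, hr0, hrε⟩⟩ :=
    ((hcone'.and hsep').and (Ioo_mem_nhdsGT hε)).exists
  have hrate : ∀ᶠ p in 𝓝 p₀, ∀ i, |p.2 i| ≤ μ := by
    rw [eventually_all]
    intro i
    have : Continuous fun p : (Fin k → ℂ) × (Fin k → ℝ) => |p.2 i| := by fun_prop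
    exact ((this.tendsto p₀).eventually (gt_mem_nhds (hμ i))).mono fun _ h => h.le
  -- The branch shrinks the `r`-ball to radius at most `μ * r`, so a displacement of its centre by
  -- `(1 - μ) * r` keeps it inside the next `r`-ball.
  have hloc : ∀ᶠ p in 𝓝 p₀, ∀ ζ ∈ Q, ∃ i, Metric.closedBall ζ r ⊆ cone p.1 i ∧
      dist (branch p i ζ) (T₀ ζ) ≤ (1 - μ) * r := by
    rw [hfin.eventually_all]
    intro ζ hζ
    obtain ⟨i, hi, hev⟩ := hcr ζ hζ
    have hc : Continuous fun p : (Fin k → ℂ) × (Fin k → ℝ) => dist (branch p i ζ) (T₀ ζ) :=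
      ((continuous_branch i).comp (f := fun p : (Fin k → ℂ) × (Fin k → ℝ) => (p, ζ))
        (by fun_prop)).dist continuous_const
    have h0 : dist (branch p₀ i ζ) (T₀ ζ) < (1 - μ) * r := by
      rw [← billiardMap_eq_branch hi, dist_self]
      exact mul_pos (by linarith) hr0
    filter_upwards [hev, (hc.tendsto p₀).eventually (gt_mem_nhds h0)] with p h1 h2
    exact ⟨i, h1, h2.le⟩
  obtain ⟨R, hR⟩ := exists_absorbing_ball p₀ hμ1
  have hent := eventually_forall_isWeakOrbit_exists_mem p₀
    (V := ⋃ ζ ∈ Q, Metric.ball ζ r) (isOpen_biUnion fun ζ _ => Metric.isOpen_ball)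
    (fun f hf => by
      obtain ⟨n, ζ, hζ, hn⟩ := hweak r hr0 f hf
      exact ⟨n, mem_iUnion₂.2 ⟨ζ, hζ, hn⟩⟩) R
  have htr : ∀ᶠ p in 𝓝 p₀, p ∈ Params k → Tracks p T₀ Q r μ := by
    filter_upwards [hrate, hloc, hR, hent] with p h1 h2 h3 h4 hp
    refine ⟨h1, fun ζ hζ => (h2 ζ hζ).imp fun i hi => hi.1, fun ζ hζ x hx => ?_, fun z hz => ?_⟩
    · obtain ⟨i, hi, hd⟩ := h2 ζ hζ
      rw [billiardMap_eq_branch (hi hx), Metric.mem_closedBall]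
      have h5 : dist (branch p i x) (branch p i ζ) ≤ μ * r := by
        rw [dist_eq_norm, branch_sub_branch, norm_mul, norm_neg, Complex.norm_real,
          Real.norm_eq_abs, ← dist_eq_norm]
        exact mul_le_mul (h1 i) hx dist_nonneg hμ0.le
      linarith [dist_triangle (branch p i x) (branch p i ζ) (T₀ ζ)]
    · obtain ⟨s, hs⟩ := hz.exists_isWeakOrbit hp
      obtain ⟨K, hK⟩ := h3 h1 (fun n => (billiardMap p)^[n] z) fun n => ⟨s n, (hs n).2.2⟩
      -- The first `K` points are dropped to have a weak orbit inside the absorbing ball.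
      obtain ⟨n, hn⟩ := h4 (fun n => ((billiardMap p)^[n + K] z, s (n + K))) (fun n => by
        have := hs (n + K)
        rwa [show n + K + 1 = n + 1 + K by ring] at this) hK
      obtain ⟨ζ, hζ, hn⟩ := mem_iUnion₂.1 hn
      exact ⟨n + K, ζ, hζ, Metric.ball_subset_closedBall hn⟩
  have hperT : MapsTo T₀ (Function.periodicPts T₀) (Function.periodicPts T₀) :=
    fun x ⟨n, hn, hx⟩ => ⟨n, hn, hx.map (Function.Commute.refl T₀)⟩
  -- The parameter `p₀` lies in its own neighbourhood, hence is modelled with `φ = id`.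
  refine ⟨(htr.self_of_nhds hp₀).isModel hp₀ hμ1 hfin hQ hsep
    (fun ζ _ => Metric.mem_closedBall_self hr0.le) fun _ _ => rfl, ?_⟩
  filter_upwards [htr] with p hp hpP
  have ht := hp hpP
  obtain ⟨φ, hφ1, hφ2⟩ := exists_tracking_orbits hr0.le hμ0.le hμ1 (hQ.inter_inter hperT)
    inter_subset_right (fun ζ hζ => ht.mapsTo ζ hζ.1) (fun ζ hζ => ht.dist_le ζ hζ.1)
  exact ⟨φ, ht.isModel hpP hμ1 hfin hQ hsep hφ1 hφ2,
    fun ζ hζ => (Metric.mem_closedBall.1 (hφ1 ζ hζ)).trans hrε.le⟩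

/-- Models of two parameters over the same periodic set give a correspondence of the limit sets
and of the periodic orbits. -/
theorem IsModel.correspondence {φ : ℂ → ℂ} (h₀ : IsModel p₀ T₀ Q id) (h : IsModel p T₀ Q φ)
    (hφ : ∀ ζ ∈ Q, dist (φ ζ) ζ ≤ ε) :
    (limitSet p).encard = (limitSet p₀).encard ∧
    Metric.hausdorffEDist (limitSet p) (limitSet p₀) ≤ ENNReal.ofReal ε ∧
    BijOn (fun Γ => φ '' Γ) {Γ | IsPeriodicOrbit p₀ Γ} {Γ | IsPeriodicOrbit p Γ} ∧
    ∀ Γ, IsPeriodicOrbit p₀ Γ → Metric.hausdorffEDist (φ '' Γ) Γ ≤ ENNReal.ofReal ε ∧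
      ∀ z ∈ Γ, ∀ z' ∈ φ '' Γ,
        Function.minimalPeriod (billiardMap p) z' = Function.minimalPeriod (billiardMap p₀) z := by
  have hdist : ∀ Γ ⊆ Q, Metric.hausdorffEDist (φ '' Γ) Γ ≤ ENNReal.ofReal ε := by
    intro Γ hΓ
    refine Metric.hausdorffEDist_le_of_mem_edist ?_ fun ζ hζ => ?_
    · rintro _ ⟨ζ, hζ, rfl⟩
      refine ⟨ζ, hζ, ?_⟩
      rw [edist_dist]
      exact ENNReal.ofReal_le_ofReal (hφ ζ (hΓ hζ))
    · refine ⟨φ ζ, mem_image_of_mem φ hζ, ?_⟩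
      rw [edist_comm, edist_dist]
      exact ENNReal.ofReal_le_ofReal (hφ ζ (hΓ hζ))
  have hsub : ∀ Γ, IsPeriodicOrbit p₀ Γ → Γ ⊆ Q := by
    intro Γ hΓ
    obtain ⟨ζ, hζ, rfl⟩ := h₀.isPeriodicOrbit_iff.1 hΓ
    rw [image_id]
    rintro _ ⟨n, rfl⟩
    exact h₀.iterate_mem hζ n
  refine ⟨?_, ?_, ⟨?_, ?_, ?_⟩, fun Γ hΓ => ⟨hdist Γ (hsub Γ hΓ), ?_⟩⟩
  · rw [h.limitSet_eq, h₀.limitSet_eq, image_id, h.injOn.encard_image]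
  · rw [h.limitSet_eq, h₀.limitSet_eq, image_id]
    exact hdist Q Subset.rfl
  · intro Γ hΓ
    obtain ⟨ζ, hζ, rfl⟩ := h₀.isPeriodicOrbit_iff.1 hΓ
    exact h.isPeriodicOrbit_iff.2 ⟨ζ, hζ, by rw [image_id]⟩
  · intro Γ hΓ Γ' hΓ' heq
    exact (h.injOn.image_eq_image_iff (hsub Γ hΓ) (hsub Γ' hΓ')).1 heq
  · intro Γ hΓ
    obtain ⟨ζ, hζ, rfl⟩ := h.isPeriodicOrbit_iff.1 hΓ
    exact ⟨_, h₀.isPeriodicOrbit_iff.2 ⟨ζ, hζ, rfl⟩, by simp only [image_id]⟩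
  · obtain ⟨ζ, hζ, rfl⟩ := h₀.isPeriodicOrbit_iff.1 hΓ
    rw [image_id]
    rintro _ ⟨m, rfl⟩ _ ⟨_, ⟨n, rfl⟩, rfl⟩
    have hmin : Function.minimalPeriod (billiardMap p₀) (T₀^[m] ζ)
        = Function.minimalPeriod T₀ (T₀^[m] ζ) := h₀.minimalPeriod_eq (h₀.iterate_mem hζ m)
    rw [h.minimalPeriod_eq (h.iterate_mem hζ n), hmin,
      Function.minimalPeriod_apply_iterate (h.periodic hζ),
      Function.minimalPeriod_apply_iterate (h.periodic hζ)]

lemma eventually_of_paramDist {k : ℕ} {q : (Fin k → ℂ) × (Fin k → ℝ)}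
    {S : (Fin k → ℂ) × (Fin k → ℝ) → Prop} (h : ∀ᶠ p in 𝓝 q, S p) :
    ∃ δ : ℝ, 0 < δ ∧ ∀ p, paramDist p q < δ → S p := by
  obtain ⟨δ, hδ, hS⟩ := Metric.eventually_nhds_iff.1 h
  -- The complex norm is at most `|re| + |im|`, so the sup distance can lose a factor 2.
  refine ⟨δ / 3, by positivity, fun p hp => hS ?_⟩
  have hd := hp.le
  rw [paramDist, Prod.norm_def, max_le_iff] at hd
  obtain ⟨h1, h2⟩ := hd
  rw [Prod.dist_eq, max_lt_iff]
  refine ⟨lt_of_le_of_lt ((dist_pi_le_iff (by positivity : 0 ≤ 2 * (δ / 3))).2 fun i => ?_)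
    (by linarith), ?_⟩
  · have h3 := (pi_norm_le_iff_of_nonneg (by positivity)).1 h1 i
    rw [Prod.norm_def, max_le_iff, Real.norm_eq_abs, Real.norm_eq_abs] at h3
    rw [dist_eq_norm]
    exact (Complex.norm_le_abs_re_add_abs_im _).trans (by linarith [h3.1, h3.2])
  · rw [dist_eq_norm]
    exact lt_of_le_of_lt h2 (by linarith)

end OuterBilliard

/-! ### The square modulo rotation. -/

namespace OuterBilliard

section Reduced

/-- The billiard map of the square modulo its rotations: the branch towards the next vertex. -/
def stepA (lam : ℝ) (u : ℝ × ℝ) : ℝ × ℝ := (1 - lam * u.2, lam * u.1)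

/-- The billiard map of the square modulo its rotations: the branch towards the opposite vertex. -/
def stepB (lam : ℝ) (u : ℝ × ℝ) : ℝ × ℝ := (lam * u.1 + 1, lam * u.2 - 1)

/-- The sum `1 + lam + ⋯ + lam ^ (n - 1)`. -/
def geomSum (lam : ℝ) (n : ℕ) : ℝ := ∑ j ∈ Finset.range n, lam ^ j

/-- The fixed point of `stepA ∘ stepB^[n]`. -/
noncomputable def fixPt (lam : ℝ) (n : ℕ) : ℝ × ℝ :=
  ((geomSum lam (n + 1) * (1 - lam ^ (n + 1)) + lam ^ (n + 1)) / (1 + (lam ^ (n + 1)) ^ 2),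
    (geomSum lam (n + 1) * (1 + lam ^ (n + 1)) - 1) / (1 + (lam ^ (n + 1)) ^ 2))

/-- The periodic points of the reduced billiard map. -/
def reducedPeriodic (lam : ℝ) : Set (ℝ × ℝ) :=
  {u | ∃ n, (fixPt lam n).1 < 1 ∧ ∃ j ≤ n, u = (stepB lam)^[j] (fixPt lam n)}

variable {lam : ℝ}

lemma geomSum_succ (n : ℕ) : geomSum lam (n + 1) = geomSum lam n + lam ^ n :=
  Finset.sum_range_succ _ _

lemma geomSum_succ' (n : ℕ) : geomSum lam (n + 1) = 1 + lam * geomSum lam n := by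
  rw [geomSum, Finset.sum_range_succ', geomSum, Finset.mul_sum, pow_zero, add_comm]
  simp only [pow_succ']

lemma geomSum_mul (n : ℕ) : (1 - lam) * geomSum lam n = 1 - lam ^ n := by
  linarith [geomSum_succ (lam := lam) n, geomSum_succ' (lam := lam) n]

lemma geomSum_mono (h0 : 0 < lam) {m n : ℕ} (h : m ≤ n) : geomSum lam m ≤ geomSum lam n :=
  Finset.sum_le_sum_of_subset_of_nonneg (Finset.range_mono h) fun _ _ _ => pow_nonneg h0.le _

lemma geomSum_nonneg (h0 : 0 < lam) (n : ℕ) : 0 ≤ geomSum lam n :=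
  Finset.sum_nonneg fun _ _ => pow_nonneg h0.le _

lemma stepB_iterate (n : ℕ) (u : ℝ × ℝ) :
    (stepB lam)^[n] u = (lam ^ n * u.1 + geomSum lam n, lam ^ n * u.2 - geomSum lam n) := by
  induction n with
  | zero => simp [geomSum]
  | succ n ih =>
    rw [Function.iterate_succ_apply', ih, stepB, geomSum_succ']
    ext <;> simp only <;> ring

lemma stepA_stepB_iterate (n : ℕ) (u : ℝ × ℝ) : stepA lam ((stepB lam)^[n] u) =
    (geomSum lam (n + 1) - lam ^ (n + 1) * u.2,
      geomSum lam (n + 1) - 1 + lam ^ (n + 1) * u.1) := by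
  rw [stepB_iterate, stepA, geomSum_succ']
  ext <;> simp only <;> ring

lemma fixPt_eq (n : ℕ) : stepA lam ((stepB lam)^[n] (fixPt lam n)) = fixPt lam n := by
  have : 1 + (lam ^ (n + 1)) ^ 2 ≠ 0 := by positivity
  rw [stepA_stepB_iterate, fixPt]
  ext <;> simp only <;> field_simp <;> ring

lemma fixPt_fst_pos (h0 : 0 < lam) (h1 : lam < 1) (n : ℕ) : 0 < (fixPt lam n).1 := by
  have := geomSum_nonneg h0 (n + 1)
  have hq : lam ^ (n + 1) < 1 := pow_lt_one₀ h0.le h1 (by omega)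
  refine div_pos (add_pos_of_nonneg_of_pos (mul_nonneg this (by linarith)) (by positivity))
    (by positivity)

/-- The left side of the conclusion is at least `3 / 4` while `lam ^ n` tends to 0, so only finitely
many `n` give periodic orbits. -/
lemma lt_pow_of_fixPt_fst_lt_one (h0 : 0 < lam) (h1 : lam < 1) {n : ℕ}
    (h : (fixPt lam n).1 < 1) : 1 - lam ^ (n + 1) + (lam ^ (n + 1)) ^ 2 < lam ^ n := by
  have hs := geomSum_mul (lam := lam) (n + 1)
  rw [fixPt, div_lt_one (by positivity), ← mul_lt_mul_iff_right₀ (by linarith : 0 < 1 - lam)] at h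
  have e1 : (1 - lam) * (geomSum lam (n + 1) * (1 - lam ^ (n + 1)) + lam ^ (n + 1)) =
      (1 - lam ^ (n + 1)) * (1 - lam ^ (n + 1)) + (1 - lam) * lam ^ (n + 1) := by
    rw [← hs]; ring
  rw [e1] at h
  refine lt_of_mul_lt_mul_left ?_ h0.le
  rw [← pow_succ']
  linarith

/-- Clearing denominators gives `lam` times the polynomial of index `n + 1`. In this case the last
point before the step A has ordinate 0, on the boundary of the quadrant. -/
lemma fixPt_fst_eq_one (h0 : 0 < lam) (h1 : lam < 1) {n : ℕ} (h : (fixPt lam n).1 = 1) :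
    lam ∈ bifurcationValues := by
  have hs := geomSum_mul (lam := lam) (n + 1)
  rw [fixPt, div_eq_one_iff_eq (by positivity)] at h
  refine ⟨h0.le, h1, n + 1, by omega, mul_left_cancel₀ h0.ne' ?_⟩
  rw [Nat.add_sub_cancel, pow_mul', mul_zero]
  linear_combination (1 - lam) * h - (1 - lam ^ (n + 1)) * hs

lemma fixPt_snd_nonneg (h0 : 0 < lam) (n : ℕ) : 0 ≤ (fixPt lam n).2 := by
  have h1 := geomSum_succ' (lam := lam) n
  have h2 := geomSum_nonneg h0 n
  have hq : 0 < lam ^ (n + 1) := by positivity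
  refine div_nonneg ?_ (by positivity)
  rw [h1]
  nlinarith [mul_nonneg h0.le h2, mul_nonneg (mul_nonneg h0.le h2) hq.le]

/-- Ordinates decrease along the steps B, so only the last one matters; it is positive because
`stepA` sends it to the abscissa `1 - lam * y`, which is below 1. -/
lemma reducedPeriodic_pos (h0 : 0 < lam) (h1 : lam < 1) {u : ℝ × ℝ}
    (hu : u ∈ reducedPeriodic lam) : 0 < u.1 ∧ 0 < u.2 := by
  obtain ⟨n, hn, j, hj, rfl⟩ := hu
  have hX := fixPt_fst_pos h0 h1 n
  have hY := fixPt_snd_nonneg h0 n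
  have hS := geomSum_nonneg h0 j
  have hlast : 0 < ((stepB lam)^[n] (fixPt lam n)).2 := by
    have h := congrArg Prod.fst (fixPt_eq (lam := lam) n)
    simp only [stepA] at h
    by_contra hneg
    nlinarith
  rw [stepB_iterate] at hlast ⊢
  refine ⟨add_pos_of_pos_of_nonneg (by positivity) hS, lt_of_lt_of_le hlast ?_⟩
  exact sub_le_sub (mul_le_mul_of_nonneg_right (pow_le_pow_of_le_one h0.le h1.le hj) hY)
    (geomSum_mono h0 hj)

lemma reducedPeriodic_step {u : ℝ × ℝ} (hu : u ∈ reducedPeriodic lam) :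
    stepA lam u ∈ reducedPeriodic lam ∨ stepB lam u ∈ reducedPeriodic lam := by
  obtain ⟨n, hn, j, hj, rfl⟩ := hu
  rcases hj.eq_or_lt with rfl | hj
  · exact Or.inl ⟨j, hn, 0, Nat.zero_le _, fixPt_eq j⟩
  · exact Or.inr ⟨n, hn, j + 1, hj, (Function.iterate_succ_apply' _ _ _).symm⟩

lemma finite_reducedPeriodic (h0 : 0 < lam) (h1 : lam < 1) : (reducedPeriodic lam).Finite := by
  have hfin : {n | (fixPt lam n).1 < 1}.Finite := by
    obtain ⟨N, hN⟩ := eventually_atTop.1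
      ((tendsto_pow_atTop_nhds_zero_of_lt_one h0.le h1).eventually
        (gt_mem_nhds (by norm_num : (0 : ℝ) < 3 / 4)))
    refine (finite_lt_nat N).subset fun n hn => ?_
    by_contra hlt
    have h2 := hN n (not_lt.1 hlt)
    have h3 := lt_pow_of_fixPt_fst_lt_one h0 h1 hn
    nlinarith [sq_nonneg (lam ^ (n + 1) - 1 / 2)]
  refine (hfin.biUnion fun n _ => (finite_le_nat n).image
    fun j => (stepB lam)^[j] (fixPt lam n)).subset ?_
  rintro u ⟨n, hn, j, hj, rfl⟩
  exact mem_iUnion₂.2 ⟨n, hn, j, hj, rfl⟩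

/-- Away from the bifurcation values all weak orbits of the reduced billiard map approach a
periodic point. -/
theorem exists_dist_reducedPeriodic_lt (h0 : 0 < lam) (h1 : lam < 1)
    (hΛ : lam ∉ bifurcationValues) {u : ℕ → ℝ × ℝ} (hnn : ∀ m, 0 ≤ (u m).1 ∧ 0 ≤ (u m).2)
    (hstep : ∀ m, u (m + 1) = stepA lam (u m) ∨ u (m + 1) = stepB lam (u m)) {r : ℝ}
    (hr : 0 < r) : ∃ m, ∃ v ∈ reducedPeriodic lam, dist (u m) v < r := by
  -- A step B lowers the ordinate by at least 1 and ordinates stay nonnegative, so a step A must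
  -- come.
  have hblock : ∀ N : ℕ, ∀ m, (u m).2 < N →
      ∃ n, u (m + n) = (stepB lam)^[n] (u m) ∧ u (m + n + 1) = stepA lam (u (m + n)) := by
    intro N
    induction N with
    | zero => exact fun m hm => absurd (hnn m).2 (by simpa using hm)
    | succ N ih =>
      intro m hm
      rcases hstep m with h | h
      · exact ⟨0, rfl, h⟩
      · have h2 : (u (m + 1)).2 = lam * (u m).2 - 1 := by rw [h]; rfl
        push_cast at hm
        obtain ⟨n, hn, hn'⟩ := ih (m + 1) (by nlinarith [(hnn m).2])
        refine ⟨n + 1, ?_, ?_⟩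
        · rw [Function.iterate_succ_apply, ← h, ← hn, show m + (n + 1) = m + 1 + n by omega]
        · rw [show m + (n + 1) = m + 1 + n by omega]; exact hn'
  choose N hN hN' using fun m => (exists_nat_gt (u m).2).elim fun M hM => hblock M m hM
  have hret : ∀ m, u (m + N m + 1) = (geomSum lam (N m + 1) - lam ^ (N m + 1) * (u m).2,
      geomSum lam (N m + 1) - 1 + lam ^ (N m + 1) * (u m).1) := fun m => by
    rw [hN', hN, stepA_stepB_iterate]
  -- Times just after a step A; starting after the first one ensures abscissa at most 1 throughout.
  let t : ℕ → ℕ := fun l => (fun m => m + N m + 1)^[l] (0 + N 0 + 1)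
  have ht : ∀ l, t (l + 1) = t l + N (t l) + 1 := fun l => Function.iterate_succ_apply' _ _ _
  have hret' : ∀ l, u (t (l + 1)) =
      (geomSum lam (N (t l) + 1) - lam ^ (N (t l) + 1) * (u (t l)).2,
        geomSum lam (N (t l) + 1) - 1 + lam ^ (N (t l) + 1) * (u (t l)).1) := fun l => by
    rw [ht]; exact hret (t l)
  have hle1 : ∀ m, (u (m + N m + 1)).1 ≤ 1 := fun m => by
    rw [hN', stepA]
    have := mul_nonneg h0.le (hnn (m + N m)).2
    simp only; linarith
  have hx1 : ∀ l, (u (t l)).1 ≤ 1 := by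
    rintro (_ | l)
    · exact hle1 0
    · rw [ht]; exact hle1 (t l)
  -- Surviving `n' ≥ n + 1` steps B needs ordinate at least `geomSum lam (n + 1)`, but the return
  -- formula with abscissa at most 1 gives less.
  have hanti : ∀ l, N (t (l + 1)) ≤ N (t l) := by
    intro l
    by_contra hlt
    push Not at hlt
    set n := N (t l) with hn
    set n' := N (t (l + 1)) with hn'
    have hy : 0 ≤ lam ^ n' * (u (t (l + 1))).2 - geomSum lam n' := by
      have := (hnn (t (l + 1) + n')).2
      rwa [hn', hN, stepB_iterate] at this
    have hy1 := (hnn (t (l + 1))).2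
    have hp : lam ^ n' ≤ 1 := pow_le_one₀ h0.le h1.le
    have hy2 : (u (t (l + 1))).2 = geomSum lam (n + 1) - 1 + lam ^ (n + 1) * (u (t l)).1 := by
      rw [hret']
    have hq : lam ^ (n + 1) < 1 := pow_lt_one₀ h0.le h1 (by omega)
    have hq0 : 0 < lam ^ (n + 1) := by positivity
    have hS := geomSum_mono h0 (show n + 1 ≤ n' from hlt)
    nlinarith [mul_le_mul_of_nonneg_left (hx1 l) hq0.le, mul_le_mul_of_nonneg_right hp hy1]
  have hanti' : Antitone fun l => N (t l) := antitone_nat_of_succ_le hanti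
  obtain ⟨l₀, hl₀⟩ : ∃ l₀, ∀ l, N (t l₀) ≤ N (t l) :=
    ⟨Function.argmin (fun l => N (t l)), fun l => Function.argmin_le (fun l => N (t l)) l⟩
  set n := N (t l₀) with hn
  have hconst : ∀ l, N (t (l₀ + l)) = n := fun l =>
    le_antisymm (hanti' (Nat.le_add_right l₀ l)) (hl₀ _)
  set q := lam ^ (n + 1) with hq
  have hq0 : 0 < q := by positivity
  have hq1 : q < 1 := pow_lt_one₀ h0.le h1 (by omega)
  have hfix := fixPt_eq (lam := lam) n
  rw [stepA_stepB_iterate, Prod.ext_iff] at hfix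
  obtain ⟨hf1, hf2⟩ := hfix
  simp only at hf1 hf2
  have hcontr : ∀ l, dist (u (t (l₀ + l))) (fixPt lam n) ≤
      q ^ l * dist (u (t l₀)) (fixPt lam n) := by
    intro l
    induction l with
    | zero => simp
    | succ l ih =>
      have h2 : dist (u (t (l₀ + (l + 1)))) (fixPt lam n) ≤
          q * dist (u (t (l₀ + l))) (fixPt lam n) := by
        have h3 := hret' (l₀ + l)
        rw [hconst l] at h3
        rw [← add_assoc, h3, Prod.dist_eq, Prod.dist_eq, Real.dist_eq, Real.dist_eq, Real.dist_eq,
          Real.dist_eq]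
        refine max_le ?_ ?_
        · rw [show geomSum lam (n + 1) - lam ^ (n + 1) * (u (t (l₀ + l))).2 - (fixPt lam n).1 =
            -(q * ((u (t (l₀ + l))).2 - (fixPt lam n).2)) by linear_combination hf1, abs_neg,
            abs_mul, abs_of_pos hq0]
          exact mul_le_mul_of_nonneg_left (le_max_right _ _) hq0.le
        · rw [show geomSum lam (n + 1) - 1 + lam ^ (n + 1) * (u (t (l₀ + l))).1 - (fixPt lam n).2 =
            q * ((u (t (l₀ + l))).1 - (fixPt lam n).1) by linear_combination hf2,
            abs_mul, abs_of_pos hq0]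
          exact mul_le_mul_of_nonneg_left (le_max_left _ _) hq0.le
      rw [pow_succ']
      nlinarith
  have hlim : Tendsto (fun l => q ^ l * dist (u (t l₀)) (fixPt lam n)) atTop (𝓝 0) := by
    simpa using (tendsto_pow_atTop_nhds_zero_of_lt_one hq0.le hq1).mul_const _
  have hconv : Tendsto (fun l => u (t (l₀ + l))) atTop (𝓝 (fixPt lam n)) :=
    tendsto_iff_dist_tendsto_zero.2 (squeeze_zero (fun _ => dist_nonneg) hcontr hlim)
  have hX1 : (fixPt lam n).1 ≤ 1 :=
    le_of_tendsto ((continuous_fst.tendsto _).comp hconv) (Eventually.of_forall fun l => hx1 _)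
  -- The limit only gives `≤ 1`; this is where the bifurcation values must be excluded.
  have hX : (fixPt lam n).1 < 1 := lt_of_le_of_ne hX1 fun h => hΛ (fixPt_fst_eq_one h0 h1 h)
  obtain ⟨l, hl⟩ := (hconv.eventually (Metric.ball_mem_nhds _ hr)).exists
  exact ⟨_, _, ⟨n, hX, 0, Nat.zero_le _, rfl⟩, hl⟩

end Reduced

/-! ### Charts of the square. -/

section Square

/-- Coordinates adapted to the vertex `i` of the square, in which its cone is the open first
quadrant. -/
def chart : Fin 4 → ℂ → ℝ × ℝ :=
  ![fun z => (z.re, z.im), fun z => (z.im + 1, -z.re), fun z => (1 - z.re, -1 - z.im),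
    fun z => (-z.im, z.re - 1)]

/-- The inverse of `chart i`. -/
def unchart : Fin 4 → ℝ × ℝ → ℂ :=
  ![fun u => ⟨u.1, u.2⟩, fun u => ⟨-u.2, u.1 - 1⟩, fun u => ⟨1 - u.1, -1 - u.2⟩,
    fun u => ⟨u.2 + 1, -u.1⟩]

lemma unchart_chart (i : Fin 4) (z : ℂ) : unchart i (chart i z) = z := by
  fin_cases i <;> apply Complex.ext <;> simp [chart, unchart]

lemma chart_unchart (i : Fin 4) (u : ℝ × ℝ) : chart i (unchart i u) = u := by
  fin_cases i <;> ext <;> simp [chart, unchart]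

lemma dist_unchart_le (i : Fin 4) (u v : ℝ × ℝ) :
    dist (unchart i u) (unchart i v) ≤ 2 * dist u v := by
  have h1 : |u.1 - v.1| ≤ dist u v := by rw [← Real.dist_eq, Prod.dist_eq]; exact le_max_left _ _
  have h2 : |u.2 - v.2| ≤ dist u v := by rw [← Real.dist_eq, Prod.dist_eq]; exact le_max_right _ _
  have h3 : |(unchart i u - unchart i v).re| + |(unchart i u - unchart i v).im| =
      |u.1 - v.1| + |u.2 - v.2| := by
    fin_cases i
    · rfl
    · change |-u.2 - -v.2| + |u.1 - 1 - (v.1 - 1)| = _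
      rw [neg_sub_neg, abs_sub_comm v.2, sub_sub_sub_cancel_right, add_comm]
    · change |1 - u.1 - (1 - v.1)| + |-1 - u.2 - (-1 - v.2)| = _
      rw [sub_sub_sub_cancel_left, sub_sub_sub_cancel_left, abs_sub_comm v.1, abs_sub_comm v.2]
    · change |u.2 + 1 - (v.2 + 1)| + |-u.1 - -v.1| = _
      rw [neg_sub_neg, abs_sub_comm v.1, add_sub_add_right_eq_sub, add_comm]
  rw [dist_eq_norm]
  exact (Complex.norm_le_abs_re_add_abs_im _).trans (by linarith)

variable {lam : ℝ}

lemma chart_branch_add_one (i : Fin 4) (z : ℂ) :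
    chart (i + 1) (branch (squareParam lam) i z) = stepA lam (chart i z) := by
  fin_cases i <;> ext <;> simp [chart, branch, squareParam, stepA] <;> ring

lemma chart_branch_add_two (i : Fin 4) (z : ℂ) :
    chart (i + 2) (branch (squareParam lam) i z) = stepB lam (chart i z) := by
  fin_cases i <;> ext <;> simp [chart, branch, squareParam, stepB] <;> ring

/-- The ordinate is negative, so the symbol `i + 3` never follows `i`, even for weak orbits. -/
lemma chart_branch_add_three (i : Fin 4) (z : ℂ) :
    (chart (i + 3) (branch (squareParam lam) i z)).2 = -(1 + lam * (chart i z).1) := by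
  fin_cases i <;> simp [chart, branch, squareParam] <;> ring

lemma mem_cone_square_iff (i : Fin 4) (z : ℂ) : z ∈ cone (squareParam lam).1 i ↔
    0 < (chart i z).1 ∧ 0 < (chart i z).2 := by
  fin_cases i <;>
  simp [cone, Fin.forall_fin_succ, squareParam, cross, chart] <;>
  constructor <;> intro h <;> (try refine ⟨?_, ?_, ?_⟩) <;> (try constructor) <;> nlinarith

lemma chart_nonneg {i : Fin 4} {z : ℂ} (h : ∀ j, 0 ≤
    cross ((squareParam lam).1 i - z) ((squareParam lam).1 j - z)) :
    0 ≤ (chart i z).1 ∧ 0 ≤ (chart i z).2 := by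
  fin_cases i <;>
  simp [Fin.forall_fin_succ, squareParam, cross, chart] at h ⊢ <;>
  constructor <;> nlinarith

lemma squareParam_mem_Params (h0 : 0 < lam) (h1 : lam < 1) : squareParam lam ∈ Params 4 := by
  refine ⟨⟨by norm_num, ?_⟩, rfl, fun _ => ⟨h0, h1⟩⟩
  intro i j
  fin_cases i <;> fin_cases j <;> simp [squareParam, cross]

end Square

end OuterBilliard

/-! ### Weak orbits of the square and the conclusion. -/

namespace OuterBilliard

section SquareLimit

variable {lam : ℝ}

/-- The points of the plane that lie over the periodic points of the reduced billiard map. -/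
def squarePeriodic (lam : ℝ) : Set ℂ := {z | ∃ i, chart i z ∈ reducedPeriodic lam}

lemma finite_squarePeriodic (h0 : 0 < lam) (h1 : lam < 1) : (squarePeriodic lam).Finite := by
  refine (finite_iUnion fun i : Fin 4 => (finite_reducedPeriodic h0 h1).image (unchart i)).subset ?_
  rintro z ⟨i, hi⟩
  exact mem_iUnion.2 ⟨i, _, hi, unchart_chart i z⟩

lemma squarePeriodic_subset_cone (h0 : 0 < lam) (h1 : lam < 1) {z : ℂ}
    (hz : z ∈ squarePeriodic lam) : ∃ i, z ∈ cone (squareParam lam).1 i := by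
  obtain ⟨i, hi⟩ := hz
  exact ⟨i, (mem_cone_square_iff i z).2 (reducedPeriodic_pos h0 h1 hi)⟩

lemma mapsTo_squarePeriodic (h0 : 0 < lam) (h1 : lam < 1) :
    MapsTo (billiardMap (squareParam lam)) (squarePeriodic lam) (squarePeriodic lam) := by
  rintro z ⟨i, hi⟩
  rw [billiardMap_eq_branch ((mem_cone_square_iff i z).2 (reducedPeriodic_pos h0 h1 hi))]
  rcases reducedPeriodic_step hi with h | h
  · exact ⟨i + 1, by rwa [chart_branch_add_one]⟩
  · exact ⟨i + 2, by rwa [chart_branch_add_two]⟩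

lemma exists_dist_squarePeriodic_lt (h0 : 0 < lam) (h1 : lam < 1) (hΛ : lam ∉ bifurcationValues)
    {r : ℝ} (hr : 0 < r) {f : ℕ → ℂ × Fin 4} (hf : IsWeakOrbit (squareParam lam) f) :
    ∃ n, ∃ ζ ∈ squarePeriodic lam, dist (f n).1 ζ < r := by
  have hnn : ∀ n, 0 ≤ (chart (f n).2 (f n).1).1 ∧ 0 ≤ (chart (f n).2 (f n).1).2 :=
    fun n => chart_nonneg (hf n).1
  have hnext : ∀ i j : Fin 4, j ≠ i → j = i + 1 ∨ j = i + 2 ∨ j = i + 3 := by decide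
  have hstep : ∀ n, chart (f (n + 1)).2 (f (n + 1)).1 = stepA lam (chart (f n).2 (f n).1) ∨
      chart (f (n + 1)).2 (f (n + 1)).1 = stepB lam (chart (f n).2 (f n).1) := by
    intro n
    obtain ⟨-, h2, h3⟩ := hf n
    rcases hnext _ _ h2 with h | h | h
    · rw [h, h3, chart_branch_add_one]; exact Or.inl rfl
    · rw [h, h3, chart_branch_add_two]; exact Or.inr rfl
    · have h4 := (hnn (n + 1)).2
      rw [h, h3, chart_branch_add_three] at h4
      linarith [mul_nonneg h0.le (hnn n).1]
  obtain ⟨n, v, hv, hd⟩ := exists_dist_reducedPeriodic_lt h0 h1 hΛ hnn hstep (half_pos hr)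
  refine ⟨n, unchart (f n).2 v, ⟨(f n).2, by rwa [chart_unchart]⟩, ?_⟩
  have := dist_unchart_le (f n).2 (chart (f n).2 (f n).1) v
  rw [unchart_chart] at this
  linarith

end SquareLimit

end OuterBilliard

theorem mainTheorem3 (lam : ℝ) (hlam : lam ∈ Set.Ioo (0 : ℝ) 1)
    (hΛ : lam ∉ OuterBilliard.bifurcationValues) (ε : ℝ) (hε : 0 < ε) :
    ∃ δ : ℝ, 0 < δ ∧ ∀ p ∈ OuterBilliard.Params 4,
      OuterBilliard.paramDist p (OuterBilliard.squareParam lam) < δ →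
        OuterBilliard.AsymptoticallyPeriodic p ∧
        (OuterBilliard.limitSet p).encard =
          (OuterBilliard.limitSet (OuterBilliard.squareParam lam)).encard ∧
        Metric.hausdorffEDist (OuterBilliard.limitSet p)
          (OuterBilliard.limitSet (OuterBilliard.squareParam lam)) < ENNReal.ofReal ε ∧
        ∃ e : Set ℂ → Set ℂ,
          Set.BijOn e
            {Γ | OuterBilliard.IsPeriodicOrbit (OuterBilliard.squareParam lam) Γ}
            {Γ | OuterBilliard.IsPeriodicOrbit p Γ} ∧
          ∀ Γ, OuterBilliard.IsPeriodicOrbit (OuterBilliard.squareParam lam) Γ →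
            Metric.hausdorffEDist (e Γ) Γ < ENNReal.ofReal ε ∧
            ∀ z ∈ Γ, ∀ z' ∈ e Γ,
              Function.minimalPeriod (OuterBilliard.billiardMap p) z' =
                Function.minimalPeriod
                  (OuterBilliard.billiardMap (OuterBilliard.squareParam lam)) z := by
  obtain ⟨h0, h1⟩ := hlam
  -- The criterion is applied with `ε / 2` because it yields only non-strict distance bounds.
  obtain ⟨hmodel, hev⟩ := OuterBilliard.eventually_exists_isModel
    (OuterBilliard.squareParam_mem_Params h0 h1) (OuterBilliard.finite_squarePeriodic h0 h1)
    (OuterBilliard.mapsTo_squarePeriodic h0 h1)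
    (fun ζ hζ => OuterBilliard.squarePeriodic_subset_cone h0 h1 hζ)
    (fun r hr f hf => OuterBilliard.exists_dist_squarePeriodic_lt h0 h1 hΛ hr hf) (half_pos hε)
  obtain ⟨δ, hδ, hS⟩ := OuterBilliard.eventually_of_paramDist hev
  refine ⟨δ, hδ, fun p hp hd => ?_⟩
  obtain ⟨φ, hφ, hdist⟩ := hS p hd hp
  obtain ⟨hcard, hhaus, hbij, horb⟩ := hmodel.correspondence hφ hdist
  have hlt : ENNReal.ofReal (ε / 2) < ENNReal.ofReal ε :=
    (ENNReal.ofReal_lt_ofReal_iff hε).2 (half_lt_self hε)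
  exact ⟨hφ.asymptoticallyPeriodic, hcard, hhaus.trans_lt hlt, _, hbij,
    fun Γ hΓ => ⟨(horb Γ hΓ).1.trans_lt hlt, (horb Γ hΓ).2⟩⟩
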